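/- Let $K$ be a field of characteristic zero and let $A_2=K\langle x_1,x_2\rangle$ be the free associative unital $K$-algebra on two generators, with bracket $[a,b]=ab-ba$. Put $L_1(A_2)=A_2$, let $L_{i}(A_2)=[A_2,L_{i-1}(A_2)]$ be the linear span of all $[a,\ell]$ with $a\in A_2$, $\ell\in L_{i-1}(A_2)$ for $i\ge 2$, and let $M_i(A_2)$ be the two-sided ideal of $A_2$ generated by $L_i(A_2)$. A pure commutator of length $m$ is a right-normed commutator $[x_{j_1},[x_{j_2},\dots,[x_{j_{m-1}},x_{j_m}]\cdots]]$ of generators (for $m=1$, a single generator). For $i\ge 2$, let $\mathcal{S}_i$ be the set of all nonzero finite products $P$ of pure commutators, each of length at least two, such that $P\in M_i(A_2)$ but $P\notin M_{i+1}(A_2)$, and let $\langle\mathcal{S}_i\rangle$ be the two-sided ideal generated by $\mathcal{S}_i$. Theorem. For every $i\ge 2$, the ideal $M_i(A_2)$ is generated by the relations $P=0$ for $P\in\mathcal{S}_i$, i.e. $M_i(A_2)=\langle\mathcal{S}_i\rangle$. Hence the universal Lie nilpotent algebra $Q_i(A_2)=A_2/M_i(A_2)$ is isomorphic to $A_2/\langle\mathcal{S}_i\rangle$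 as a $K$-algebra (in particular as a vector space), via the map induced by the identity of $A_2$. -/

import Mathlib

namespace LowerCentral

/-- The free associative unital algebra `A_n` over `K` on the generators `x_0, …, x_{n-1}`. -/
abbrev A (K : Type*) [Field K] (n : ℕ) : Type _ := FreeAlgebra K (Fin n)

/-- The lower central series of the algebra `R` under the bracket `⁅a, b⁆ = a * b - b * a`, indexed
from one: `L_1 = R`, and `L_{i+1} = [R, L_i]` is the linear span of the commutators `⁅a, l⁆` with
`l ∈ L_i`. The value at index `0` is irrelevant. -/
def L (K R : Type*) [Field K] [Ring R] [Algebra K R] : ℕ → Submodule K R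
  | 0 => ⊤
  | 1 => ⊤
  | i + 2 => Submodule.span K {x | ∃ a : R, ∃ l ∈ L K R (i + 1), x = ⁅a, l⁆}

/-- `M_i`, the two-sided ideal generated by `L_i`. -/
noncomputable def M (K R : Type*) [Field K] [Ring R] [Algebra K R] (i : ℕ) : TwoSidedIdeal R :=
  TwoSidedIdeal.span (L K R i : Set R)

/-- The right-normed commutator `[x_{j_1}, [x_{j_2}, …, [x_{j_{m-1}}, x_{j_m}]]]` of the generators
listed in `w = [j_1, …, j_m]`; a single generator is its own commutator of length one. The value at
the empty list is irrelevant. -/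
noncomputable def pureCommutator (K : Type*) [Field K] {n : ℕ} : List (Fin n) → A K n
  | [] => 0
  | [j] => FreeAlgebra.ι K j
  | j :: j' :: w => ⁅FreeAlgebra.ι K j, pureCommutator K (j' :: w)⁆

/-- `p` is a (by convention nonzero) finite product of pure commutators, each of length at
least `r`. -/
def IsPureCommutatorProduct (K : Type*) [Field K] {n : ℕ} (r : ℕ) (p : A K n) : Prop :=
  p ≠ 0 ∧ ∃ ws : List (List (Fin n)),
    (∀ w ∈ ws, r ≤ w.length) ∧ p = (ws.map (pureCommutator K)).prod

/-- `p` has a maximal inclusion in `M_i`. -/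
def HasMaximalInclusion (K R : Type*) [Field K] [Ring R] [Algebra K R] (i : ℕ) (p : R) : Prop :=
  p ∈ M K R i ∧ p ∉ M K R (i + 1)

/-- `S_i`: the products of pure commutators of length at least two that have a maximal inclusion
in `M_i(A_n)`. -/
def S (K : Type*) [Field K] (n i : ℕ) : Set (A K n) :=
  {p | IsPureCommutatorProduct K 2 p ∧ HasMaximalInclusion K (A K n) i p}

/-- The quotient algebra `R / I` by a two-sided ideal. -/
abbrev QuotAlg {R : Type*} [Ring R] (I : TwoSidedIdeal R) : Type _ := I.ringCon.Quotient

/-- The universal Lie nilpotent algebra `Q_i(A_n) = A_n / M_i(A_n)`. -/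
abbrev Q (K : Type*) [Field K] (n i : ℕ) : Type _ := QuotAlg (M K (A K n) i)

end LowerCentral

/-! Give a commutator of length `m` the weight `m - 1`, extended additively to products. The claim
behind the theorem is that `M_{k+1}` is the ideal `W_k` (`weightIdeal`) generated by the products of
weight `k`. `M_{k+1} ⊆ W_k` holds for any number of generators: the `W_k` form a decreasing
multiplicative filtration, and bracketing raises it by one (`bracket_mem_weightIdeal`). `W_k ⊆
M_{k+1}` follows from `L_m M_k ⊆ M_{m+k-1}` (`L_mul_M_mem`), which rests on `[M_2, A] ⊆ L_3`, proved
here for two generators (`lie_M_two_mem_L_three`). Finally, a representation on `K[h][X]` sends a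
nonzero product of weight `k` to a nonzero multiple of `h^k` times a power of a shift, but sends
`W_{k+1}` into multiples of `h^{k+1}`. So the nonzero generators of `W_k` lie outside `M_{k+2}`,
hence in `S_{k+1}`. -/

namespace LowerCentral

/-! ### Brackets and products in the lower central series -/

section General

variable {K R : Type*} [Field K] [Ring R] [Algebra K R]

theorem bracket_add (x y z : R) : ⁅x, y + z⁆ = ⁅x, y⁆ + ⁅x, z⁆ := by
  simp only [Ring.lie_def]
  noncomm_ring

theorem add_bracket (x y z : R) : ⁅x + y, z⁆ = ⁅x, z⁆ + ⁅y, z⁆ := by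
  simp only [Ring.lie_def]
  noncomm_ring

@[simp]
theorem bracket_zero (x : R) : ⁅x, (0 : R)⁆ = 0 := by
  simp [Ring.lie_def]

@[simp]
theorem zero_bracket (x : R) : ⁅(0 : R), x⁆ = 0 := by
  simp [Ring.lie_def]

theorem bracket_smul (x : R) (c : K) (y : R) : ⁅x, c • y⁆ = c • ⁅x, y⁆ := by
  simp only [Ring.lie_def, mul_smul_comm, smul_mul_assoc, smul_sub]

theorem smul_bracket (c : K) (x y : R) : ⁅c • x, y⁆ = c • ⁅x, y⁆ := by
  simp only [Ring.lie_def, mul_smul_comm, smul_mul_assoc, smul_sub]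

theorem bracket_skew (x y : R) : -⁅y, x⁆ = ⁅x, y⁆ := by
  simp only [Ring.lie_def, neg_sub]

theorem bracket_bracket (x y z : R) : ⁅⁅x, y⁆, z⁆ = ⁅x, ⁅y, z⁆⁆ - ⁅y, ⁅x, z⁆⁆ := by
  simp only [Ring.lie_def]
  noncomm_ring

theorem leibniz_bracket (x y z : R) : ⁅x, ⁅y, z⁆⁆ = ⁅⁅x, y⁆, z⁆ + ⁅y, ⁅x, z⁆⁆ := by
  rw [bracket_bracket, sub_add_cancel]

theorem bracket_mul (x y z : R) : ⁅x, y * z⁆ = ⁅x, y⁆ * z + y * ⁅x, z⁆ := by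
  simp only [Ring.lie_def]
  noncomm_ring

theorem mul_bracket (x y z : R) : ⁅x * y, z⁆ = ⁅x, z⁆ * y + x * ⁅y, z⁆ := by
  simp only [Ring.lie_def]
  noncomm_ring

theorem smul_mem_twoSidedIdeal (I : TwoSidedIdeal R) (c : K) {x : R} (hx : x ∈ I) : c • x ∈ I := by
  rw [Algebra.smul_def]
  exact I.mul_mem_left _ _ hx

theorem lie_mem_L (a : R) {k : ℕ} {l : R} (hl : l ∈ L K R (k + 1)) : ⁅a, l⁆ ∈ L K R (k + 2) :=
  Submodule.subset_span ⟨a, l, hl, rfl⟩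

theorem lie_mem_L' (a : R) {k : ℕ} {l : R} (hl : l ∈ L K R (k + 1)) : ⁅l, a⁆ ∈ L K R (k + 2) := by
  rw [← bracket_skew]
  exact neg_mem (lie_mem_L a hl)

theorem mem_L_one (a : R) : a ∈ L K R 1 := trivial

/-- Induction on the elements of `L_{k+2}`, spanned by the commutators with `L_{k+1}`. -/
theorem L_induction {k : ℕ} {P : R → Prop} (lie : ∀ a : R, ∀ l ∈ L K R (k + 1), P ⁅a, l⁆)
    (zero : P 0) (add : ∀ x y, P x → P y → P (x + y)) (smul : ∀ (c : K) x, P x → P (c • x))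
    {x : R} (hx : x ∈ L K R (k + 2)) : P x := by
  refine Submodule.span_induction (p := fun x _ => P x) ?_ zero (fun x y _ _ => add x y)
    (fun c x _ => smul c x) hx
  rintro _ ⟨a, l, hl, rfl⟩
  exact lie a l hl

theorem L_succ_le (k : ℕ) : L K R (k + 2) ≤ L K R (k + 1) := by
  induction k with
  | zero => exact fun x _ => mem_L_one x
  | succ k ih =>
    intro x hx
    exact L_induction (fun a l hl => lie_mem_L a (ih hl)) (zero_mem _)
      (fun _ _ => add_mem) (fun c _ => Submodule.smul_mem _ c) hx

theorem lie_L_mem {i j : ℕ} {x y : R} (hx : x ∈ L K R (i + 1)) (hy : y ∈ L K R (j + 1)) :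
    ⁅x, y⁆ ∈ L K R (i + j + 2) := by
  induction i generalizing x y j with
  | zero => simpa using lie_mem_L x hy
  | succ i ih =>
    refine L_induction (P := fun x => ⁅x, y⁆ ∈ L K R (i + 1 + j + 2)) ?_ ?_ ?_ ?_ hx
    · intro a l hl
      rw [bracket_bracket]
      refine sub_mem ?_ ?_
      · have := lie_mem_L a (ih hl hy)
        rwa [show i + j + 1 + 2 = i + 1 + j + 2 by ring] at this
      · have := ih hl (lie_mem_L a hy)
        rwa [show i + (j + 1) + 2 = i + 1 + j + 2 by ring] at this
    · simp
    · intro x y hx hy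
      rw [add_bracket]
      exact add_mem hx hy
    · intro c x hx
      rw [smul_bracket]
      exact Submodule.smul_mem _ c hx

theorem L_le_M {k : ℕ} {x : R} (hx : x ∈ L K R k) : x ∈ M K R k :=
  TwoSidedIdeal.subset_span hx

/-- If `M_2` is central modulo `L_3`, it behaves like `L_2` in all brackets with the `L_k`. -/
theorem lie_M_two_mem (h : ∀ z ∈ M K R 2, ∀ a : R, ⁅z, a⁆ ∈ L K R 3) {z : R} (hz : z ∈ M K R 2)
    {k : ℕ} {l : R} (hl : l ∈ L K R (k + 1)) : ⁅z, l⁆ ∈ L K R (k + 3) := by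
  induction k generalizing l with
  | zero => exact h z hz l
  | succ k ih =>
    refine L_induction (P := fun l => ⁅z, l⁆ ∈ L K R (k + 1 + 3)) ?_ ?_ ?_ ?_ hl
    · intro a l hl
      rw [leibniz_bracket]
      refine add_mem ?_ (lie_mem_L a (ih hl))
      have := lie_L_mem (h z hz a) hl
      rwa [show 2 + k + 2 = k + 1 + 3 by ring] at this
    · simp
    · intro x y hx hy
      rw [bracket_add]
      exact add_mem hx hy
    · intro c x hx
      rw [bracket_smul]
      exact Submodule.smul_mem _ c hx

theorem lie_lie_mul (v a b l : R) : ⁅v, a⁆ * ⁅b, l⁆ + ⁅v, b⁆ * ⁅a, l⁆ =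
    ⁅v, ⁅a * b, l⁆⁆ - a * ⁅v, ⁅b, l⁆⁆ - ⁅v, ⁅a, l⁆⁆ * b - ⁅⁅a, l⁆, ⁅v, b⁆⁆ := by
  simp only [Ring.lie_def]
  noncomm_ring

/-- By `lie_lie_mul`, the symmetrization in `a`, `b` is a combination of multiples of brackets deep
enough in the series. -/
theorem lie_mul_lie_antisymm {p k : ℕ} {v l : R} (hv : v ∈ L K R (p + 1)) (hl : l ∈ L K R (k + 1))
    (a b : R) : ⁅v, a⁆ * ⁅b, l⁆ + ⁅v, b⁆ * ⁅a, l⁆ ∈ M K R (p + k + 3) := by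
  have key (c : R) : ⁅v, ⁅c, l⁆⁆ ∈ M K R (p + k + 3) := L_le_M (lie_L_mem (j := k + 1) hv (lie_mem_L c hl))
  rw [lie_lie_mul]
  refine TwoSidedIdeal.sub_mem _ (TwoSidedIdeal.sub_mem _ (TwoSidedIdeal.sub_mem _ (key _) ?_) ?_) ?_
  · exact TwoSidedIdeal.mul_mem_left _ _ _ (key _)
  · exact TwoSidedIdeal.mul_mem_right _ _ _ (key _)
  · have := L_succ_le _ (lie_L_mem (lie_mem_L a hl) (lie_mem_L' b hv))
    rw [show k + 1 + (p + 1) + 1 = p + k + 3 by ring] at this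
    exact L_le_M this

/-- One step deeper than `lie_mul_lie_antisymm`, without symmetrizing: since `u` and `u * b` lie in
`M_2`, their brackets with `l` gain an extra step. `h₁` and `h₂` absorb the two remaining products.
-/
theorem lie_mul_lie_mem (h : ∀ z ∈ M K R 2, ∀ a : R, ⁅z, a⁆ ∈ L K R 3) {p k : ℕ} {u v l : R}
    (hu : u ∈ L K R 2) (hv : v ∈ L K R (p + 1)) (hl : l ∈ L K R (k + 1)) (b : R)
    (h₁ : ∀ x ∈ L K R 2, ∀ y ∈ L K R (p + k + 3), x * y ∈ M K R (p + k + 4))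
    (h₂ : ∀ x ∈ L K R (p + 2), ∀ y ∈ L K R (k + 3), x * y ∈ M K R (p + k + 4)) :
    ⁅v, u⁆ * ⁅b, l⁆ ∈ M K R (p + k + 4) := by
  have hM := L_le_M hu
  have key {c : R} (hc : c ∈ M K R 2) : ⁅v, ⁅c, l⁆⁆ ∈ M K R (p + k + 4) :=
    L_le_M (lie_L_mem (j := k + 2) hv (lie_M_two_mem h hc hl))
  have hul : ⁅u, l⁆ ∈ L K R (k + 3) := lie_M_two_mem h hM hl
  rw [eq_sub_of_add_eq (lie_lie_mul v u b l)]
  refine TwoSidedIdeal.sub_mem _ (TwoSidedIdeal.sub_mem _ (TwoSidedIdeal.sub_mem _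
    (TwoSidedIdeal.sub_mem _ (key (TwoSidedIdeal.mul_mem_right _ _ _ hM)) ?_) ?_) ?_) ?_
  · exact h₁ _ hu _ (lie_L_mem (j := k + 1) hv (lie_mem_L b hl))
  · exact TwoSidedIdeal.mul_mem_right _ _ _ (key hM)
  · have := L_succ_le _ (lie_L_mem hul (lie_mem_L' b hv))
    rw [show k + 2 + (p + 1) + 1 = p + k + 4 by ring] at this
    exact L_le_M this
  · exact h₂ _ (lie_mem_L' b hv) _ hul

theorem mul_mem_of_lie_generators {i j N : ℕ}
    (h : ∀ a : R, ∀ v ∈ L K R (i + 1), ∀ b : R, ∀ l ∈ L K R (j + 1), ⁅a, v⁆ * ⁅b, l⁆ ∈ M K R N)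
    {x y : R} (hx : x ∈ L K R (i + 2)) (hy : y ∈ L K R (j + 2)) : x * y ∈ M K R N := by
  refine L_induction (P := fun x => x * y ∈ M K R N) ?_ ?_ ?_ ?_ hx
  · intro a v hv
    refine L_induction (P := fun y => ⁅a, v⁆ * y ∈ M K R N) (h a v hv) ?_ ?_ ?_ hy
    · simp
    · intro x y hx hy
      rw [mul_add]
      exact TwoSidedIdeal.add_mem _ hx hy
    · intro c x hx
      rw [mul_smul_comm]
      exact smul_mem_twoSidedIdeal _ c hx
  · simp
  · intro x y hx hy
    rw [add_mul]
    exact TwoSidedIdeal.add_mem _ hx hy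
  · intro c x hx
    rw [smul_mul_assoc]
    exact smul_mem_twoSidedIdeal _ c hx

theorem L_two_mul_L_mem (h : ∀ z ∈ M K R 2, ∀ a : R, ⁅z, a⁆ ∈ L K R 3) {k : ℕ} {x y : R}
    (hx : x ∈ L K R 2) (hy : y ∈ L K R (k + 1)) : x * y ∈ M K R (k + 2) := by
  cases k with
  | zero => exact TwoSidedIdeal.mul_mem_right _ _ _ (L_le_M hx)
  | succ k =>
    refine mul_mem_of_lie_generators (i := 0) ?_ hx hy
    intro a v hv b l hl
    have hu : ⁅a, v⁆ ∈ M K R 2 := L_le_M (lie_mem_L a hv)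
    have : ⁅a, v⁆ * ⁅b, l⁆ = ⁅⁅a, v⁆ * b, l⁆ - ⁅⁅a, v⁆, l⁆ * b := by
      simp only [Ring.lie_def]
      noncomm_ring
    rw [this]
    exact TwoSidedIdeal.sub_mem _
      (L_le_M (lie_M_two_mem h (TwoSidedIdeal.mul_mem_right _ _ _ hu) hl))
      (TwoSidedIdeal.mul_mem_right _ _ _ (L_le_M (lie_M_two_mem h hu hl)))

/-- If `M_2` is central modulo `L_3`, then `L_m L_k ⊆ M_{m+k-1}` for all `m, k ≥ 1`. -/
theorem L_mul_L_mem [CharZero K] (h : ∀ z ∈ M K R 2, ∀ a : R, ⁅z, a⁆ ∈ L K R 3) {m k : ℕ} {x y : R}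
    (hx : x ∈ L K R (m + 1)) (hy : y ∈ L K R (k + 1)) : x * y ∈ M K R (m + k + 1) := by
  induction m using Nat.strong_induction_on generalizing k x y with
  | _ m ih =>
  match m, k, ih, hx, hy with
  | 0, k, _, _, hy =>
    rw [zero_add]
    exact TwoSidedIdeal.mul_mem_left _ _ _ (L_le_M hy)
  | 1, k, _, hx, hy =>
    rw [show 1 + k + 1 = k + 2 by ring]
    exact L_two_mul_L_mem h hx hy
  | m + 2, 0, _, hx, _ => exact TwoSidedIdeal.mul_mem_right _ _ _ (L_le_M hx)
  | p + 2, k + 1, ih, hx, hy =>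
    rw [show p + 2 + (k + 1) + 1 = p + k + 4 by ring]
    refine mul_mem_of_lie_generators ?_ hx hy
    intro a z hz b l hl
    refine L_induction (P := fun z => ⁅a, z⁆ * ⁅b, l⁆ ∈ M K R (p + k + 4)) ?_ ?_ ?_ ?_ hz
    -- Write `T(a, d, b) = ⁅a, ⁅d, v⁆⁆ * ⁅b, l⁆`. Modulo the ideal it is antisymmetric in `a, b` and
    -- symmetric in `a, d`, as `⁅a, ⁅d, v⁆⁆ - ⁅d, ⁅a, v⁆⁆ = ⁅⁅a, d⁆, v⁆`. The two transpositions are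
    -- conjugate in the symmetric group, so `2T` vanishes.
    · intro d v hv
      have anti (a d b : R) :
          ⁅a, ⁅d, v⁆⁆ * ⁅b, l⁆ + ⁅b, ⁅d, v⁆⁆ * ⁅a, l⁆ ∈ M K R (p + k + 4) := by
        have := TwoSidedIdeal.neg_mem _ (lie_mul_lie_antisymm (lie_mem_L d hv) hl a b)
        rw [show p + 1 + k + 3 = p + k + 4 by ring] at this
        rwa [← bracket_skew a ⁅d, v⁆, ← bracket_skew b ⁅d, v⁆, neg_mul, neg_mul, ← neg_add]
      have symm (a d b : R) :
          ⁅a, ⁅d, v⁆⁆ * ⁅b, l⁆ - ⁅d, ⁅a, v⁆⁆ * ⁅b, l⁆ ∈ M K R (p + k + 4) := by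
        rw [← sub_mul, ← bracket_bracket, ← bracket_skew, neg_mul]
        refine TwoSidedIdeal.neg_mem _ (lie_mul_lie_mem h (lie_mem_L a (mem_L_one d)) hv hl b ?_ ?_)
        · intro x hx y hy
          exact L_two_mul_L_mem h hx hy
        · intro x hx y hy
          have := ih (p + 1) (by omega) hx hy
          rwa [show p + 1 + (k + 2) + 1 = p + k + 4 by ring] at this
      have two : ⁅a, ⁅d, v⁆⁆ * ⁅b, l⁆ + ⁅a, ⁅d, v⁆⁆ * ⁅b, l⁆ ∈ M K R (p + k + 4) := by
        have := TwoSidedIdeal.add_mem _ (TwoSidedIdeal.add_mem _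
          (TwoSidedIdeal.add_mem _ (symm a d b) (anti d a b))
          (TwoSidedIdeal.neg_mem _ (TwoSidedIdeal.add_mem _ (symm b a d) (anti a b d))))
          (TwoSidedIdeal.add_mem _ (symm d b a) (anti b d a))
        convert this using 1
        abel
      have := smul_mem_twoSidedIdeal _ (2⁻¹ : K) two
      rwa [← two_smul K, smul_smul, inv_mul_cancel₀ two_ne_zero, one_smul] at this
    · simp
    · intro x y hx hy
      rw [bracket_add, add_mul]
      exact TwoSidedIdeal.add_mem _ hx hy
    · intro c x hx
      rw [bracket_smul, smul_mul_assoc]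
      exact smul_mem_twoSidedIdeal _ c hx

theorem L_mul_M_mem [CharZero K] (h : ∀ z ∈ M K R 2, ∀ a : R, ⁅z, a⁆ ∈ L K R 3) {m k : ℕ} {x y : R}
    (hx : x ∈ L K R (m + 1)) (hy : y ∈ M K R (k + 1)) : x * y ∈ M K R (m + k + 1) := by
  revert x
  refine TwoSidedIdeal.span_induction
    (p := fun y _ => ∀ {x : R}, x ∈ L K R (m + 1) → x * y ∈ M K R (m + k + 1)) ?_ ?_ ?_ ?_ ?_ ?_ hy
  · exact fun y hy x hx => L_mul_L_mem h hx hy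
  · intro x _
    simp
  · intro y z _ _ hy hz x hx
    rw [mul_add]
    exact TwoSidedIdeal.add_mem _ (hy hx) (hz hx)
  · intro y _ hy x hx
    rw [mul_neg]
    exact TwoSidedIdeal.neg_mem _ (hy hx)
  · intro a y _ hy x hx
    have : x * (a * y) = a * (x * y) - ⁅a, x⁆ * y := by
      simp only [Ring.lie_def]
      noncomm_ring
    rw [this]
    exact TwoSidedIdeal.sub_mem _ (TwoSidedIdeal.mul_mem_left _ _ _ (hy hx))
      (hy (L_succ_le _ (lie_mem_L a hx)))
  · intro a y _ hy x hx
    rw [← mul_assoc]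
    exact TwoSidedIdeal.mul_mem_right _ _ _ (hy hx)

theorem lie_mem_L_two (a b : R) : ⁅a, b⁆ ∈ L K R 2 := lie_mem_L a (mem_L_one b)

theorem mul_lie_lie_self_mem (f x y : R) : ⁅f * ⁅x, y⁆, x⁆ ∈ L K R 3 := by
  have : ⁅f * ⁅x, y⁆, x⁆ =
      ⁅⁅f * x, y⁆, x⁆ - ⁅⁅f, y * x⁆, x⁆ - ⁅⁅f * x, x⁆, y⁆ + ⁅⁅f, x⁆, x * y⁆ := by
    simp only [Ring.lie_def]
    noncomm_ring
  rw [this]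
  have h (a b c : R) : ⁅⁅a, b⁆, c⁆ ∈ L K R 3 := lie_mem_L' c (lie_mem_L_two a b)
  exact add_mem (sub_mem (sub_mem (h _ _ _) (h _ _ _)) (h _ _ _)) (h _ _ _)

end General

/-! ### Two generators: `M_2` is central modulo `L_3` -/

section FreeAlgebra

variable {K : Type*} [Field K] {n : ℕ}

theorem pureCommutator_mem_L (w : List (Fin n)) :
    pureCommutator K w ∈ L K (A K n) w.length := by
  induction w with
  | nil => exact zero_mem _
  | cons j w ih =>
    cases w with
    | nil => exact mem_L_one _
    | cons j' w => exact lie_mem_L _ ih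

/-- In two variables, `f [x_0, x_1]` is central modulo `L_3`. -/
theorem lie_mul_lie_generators_mem (f z : A K 2) :
    ⁅f * ⁅FreeAlgebra.ι K (0 : Fin 2), FreeAlgebra.ι K 1⁆, z⁆ ∈ L K (A K 2) 3 := by
  induction z using FreeAlgebra.induction generalizing f with
  | grade0 r =>
    have : ∀ y : A K 2, ⁅y, algebraMap K (A K 2) r⁆ = 0 := fun y => by
      rw [Ring.lie_def, Algebra.commutes, sub_self]
    rw [this]
    exact zero_mem _
  | grade1 j =>
    have hj : j = 0 ∨ j = 1 := by omega
    rcases hj with rfl | rfl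
    · exact mul_lie_lie_self_mem _ _ _
    · rw [← bracket_skew (FreeAlgebra.ι K (0 : Fin 2)), mul_neg, ← neg_one_smul K, smul_bracket]
      exact Submodule.smul_mem _ _ (mul_lie_lie_self_mem _ _ _)
  | mul a b ha hb =>
    have : ∀ u : A K 2, ⁅f * u, a * b⁆ = ⁅a * f * u, b⁆ + ⁅⁅f * u, a⁆, b⁆ + ⁅b * f * u, a⁆ := by
      intro u
      simp only [Ring.lie_def]
      noncomm_ring
    rw [this]
    exact add_mem (add_mem (hb _) (lie_mem_L' _ (lie_mem_L_two _ _))) (ha _)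
  | add a b ha hb =>
    rw [bracket_add]
    exact add_mem (ha f) (hb f)

theorem bracket_mem_of_generators (I : TwoSidedIdeal (A K n))
    (h : ∀ i j : Fin n, ⁅FreeAlgebra.ι K i, FreeAlgebra.ι K j⁆ ∈ I) (a b : A K n) : ⁅a, b⁆ ∈ I := by
  induction a using FreeAlgebra.induction with
  | grade0 r =>
    rw [Ring.lie_def, Algebra.commutes, sub_self]
    exact I.zero_mem
  | grade1 i =>
    induction b using FreeAlgebra.induction with
    | grade0 r =>
      rw [Ring.lie_def, Algebra.commutes, sub_self]
      exact I.zero_mem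
    | grade1 j => exact h i j
    | mul a b ha hb =>
      rw [bracket_mul]
      exact I.add_mem (I.mul_mem_right _ _ ha) (I.mul_mem_left _ _ hb)
    | add a b ha hb =>
      rw [bracket_add]
      exact I.add_mem ha hb
  | mul a b ha hb =>
    rw [mul_bracket]
    exact I.add_mem (I.mul_mem_right _ _ ha) (I.mul_mem_left _ _ hb)
  | add a b ha hb =>
    rw [add_bracket]
    exact I.add_mem ha hb

/-- In two variables, `M_2` is central modulo `L_3`. -/
theorem lie_M_two_mem_L_three (z : A K 2) (hz : z ∈ M K (A K 2) 2) (a : A K 2) :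
    ⁅z, a⁆ ∈ L K (A K 2) 3 := by
  have hle : M K (A K 2) 2 ≤
      TwoSidedIdeal.span {⁅FreeAlgebra.ι K (0 : Fin 2), FreeAlgebra.ι K (1 : Fin 2)⁆} := by
    set J := TwoSidedIdeal.span {⁅FreeAlgebra.ι K (0 : Fin 2), FreeAlgebra.ι K (1 : Fin 2)⁆}
    have hu : ⁅FreeAlgebra.ι K (0 : Fin 2), FreeAlgebra.ι K (1 : Fin 2)⁆ ∈ J :=
      TwoSidedIdeal.subset_span rfl
    refine TwoSidedIdeal.span_le.2 fun x hx => ?_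
    refine L_induction (P := fun x => x ∈ J) ?_ J.zero_mem (fun _ _ => J.add_mem)
      (fun c _ => smul_mem_twoSidedIdeal J c) hx
    intro a l _
    refine bracket_mem_of_generators J (fun i j => ?_) a l
    have hself (x : A K 2) : ⁅x, x⁆ ∈ J := by
      rw [Ring.lie_def, sub_self]
      exact J.zero_mem
    have hi : i = 0 ∨ i = 1 := by omega
    have hj : j = 0 ∨ j = 1 := by omega
    rcases hi with rfl | rfl <;> rcases hj with rfl | rfl
    · exact hself _
    · exact hu
    · rw [← bracket_skew]
      exact J.neg_mem hu
    · exact hself _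
  -- `L_3` is not an ideal, so the induction must carry all two-sided multiples of `z`.
  suffices H : ∀ c d a, ⁅c * z * d, a⁆ ∈ L K (A K 2) 3 by simpa using H 1 1 a
  refine TwoSidedIdeal.span_induction
    (p := fun z _ => ∀ c d a, ⁅c * z * d, a⁆ ∈ L K (A K 2) 3) ?_ ?_ ?_ ?_ ?_ ?_ (hle hz)
  · rintro u rfl c d a
    have (u : A K 2) : ⁅c * u * d, a⁆ = ⁅d * c * u, a⁆ + ⁅⁅c * u, d⁆, a⁆ := by
      simp only [Ring.lie_def]
      noncomm_ring
    rw [this]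
    exact add_mem (lie_mul_lie_generators_mem _ _) (lie_mem_L' _ (lie_mem_L_two _ _))
  · simp
  · intro x y _ _ hx hy c d a
    rw [mul_add, add_mul, add_bracket]
    exact add_mem (hx c d a) (hy c d a)
  · intro x _ hx c d a
    have := hx (-c) d a
    rwa [neg_mul_comm] at this
  · intro b x _ hx c d a
    rw [← mul_assoc c]
    exact hx _ _ _
  · intro b x _ hx c d a
    rw [← mul_assoc c, mul_assoc _ b]
    exact hx _ _ _

/-! ### The weight filtration -/

/-- The weight of a product of pure commutators, a commutator of length `m` counting `m - 1`. -/
def weight (ws : List (List (Fin n))) : ℕ := (ws.map fun w => w.length - 1).sum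

/-- The products of pure commutators of length at least two of weight `k`. -/
def commutatorProducts (K : Type*) [Field K] (n k : ℕ) : Set (A K n) :=
  {p | ∃ ws : List (List (Fin n)), (∀ w ∈ ws, 2 ≤ w.length) ∧ weight ws = k ∧
    p = (ws.map (pureCommutator K)).prod}

/-- The ideal generated by the products of pure commutators of weight `k`. -/
noncomputable def weightIdeal (K : Type*) [Field K] (n k : ℕ) : TwoSidedIdeal (A K n) :=
  TwoSidedIdeal.span (commutatorProducts K n k)

theorem mem_weightIdeal {k : ℕ} {p : A K n} (hp : p ∈ commutatorProducts K n k) :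
    p ∈ weightIdeal K n k :=
  TwoSidedIdeal.subset_span hp

theorem mul_mem_commutatorProducts {k l : ℕ} {p q : A K n} (hp : p ∈ commutatorProducts K n k)
    (hq : q ∈ commutatorProducts K n l) : p * q ∈ commutatorProducts K n (k + l) := by
  obtain ⟨ws, h, rfl, rfl⟩ := hp
  obtain ⟨ws', h', rfl, rfl⟩ := hq
  refine ⟨ws ++ ws', ?_, by simp [weight], by simp⟩
  intro w hw
  rcases List.mem_append.1 hw with hw | hw
  exacts [h w hw, h' w hw]

theorem pureCommutator_mem_commutatorProducts {w : List (Fin n)} (hw : 2 ≤ w.length) :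
    pureCommutator K w ∈ commutatorProducts K n (w.length - 1) :=
  ⟨[w], by simpa using hw, by simp [weight], by simp⟩

theorem mul_mem_span_commutatorProducts {k l : ℕ} {p q : A K n}
    (hp : p ∈ Submodule.span K (commutatorProducts K n k))
    (hq : q ∈ Submodule.span K (commutatorProducts K n l)) :
    p * q ∈ Submodule.span K (commutatorProducts K n (k + l)) := by
  have := Submodule.mul_mem_mul hp hq
  rw [Submodule.span_mul_span] at this
  refine Submodule.span_mono ?_ this
  rintro _ ⟨p, hp, q, hq, rfl⟩
  exact mul_mem_commutatorProducts hp hq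

/-- By Leibniz, the generator is prepended to one factor at a time. -/
theorem bracket_ι_mem_span (j : Fin n) {k : ℕ} {p : A K n} (hp : p ∈ commutatorProducts K n k) :
    ⁅FreeAlgebra.ι K j, p⁆ ∈ Submodule.span K (commutatorProducts K n (k + 1)) := by
  obtain ⟨ws, h, rfl, rfl⟩ := hp
  induction ws with
  | nil => simp [Ring.lie_def]
  | cons w ws ih =>
    have hw : 2 ≤ w.length := h w (by simp)
    have hws : ∀ v ∈ ws, 2 ≤ v.length := fun v hv => h v (by simp [hv])
    have hwt : weight (w :: ws) = w.length - 1 + weight ws := by simp [weight]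
    rw [List.map_cons, List.prod_cons, bracket_mul, hwt]
    refine add_mem ?_ ?_
    · obtain ⟨i, w, rfl⟩ := List.exists_cons_of_ne_nil
        (List.ne_nil_of_length_pos (by omega : 0 < w.length))
      have h₁ := mul_mem_commutatorProducts (pureCommutator_mem_commutatorProducts (K := K)
        (w := j :: i :: w) (by simp)) ⟨ws, hws, rfl, rfl⟩
      rw [show (j :: i :: w).length - 1 + weight ws = (i :: w).length - 1 + weight ws + 1 by
        simp; ring] at h₁
      exact Submodule.subset_span h₁
    · rw [add_assoc]
      exact mul_mem_span_commutatorProducts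
        (Submodule.subset_span (pureCommutator_mem_commutatorProducts hw)) (ih hws)

theorem span_le_weightIdeal {k : ℕ} {p : A K n}
    (hp : p ∈ Submodule.span K (commutatorProducts K n k)) : p ∈ weightIdeal K n k := by
  refine Submodule.span_induction (p := fun p _ => p ∈ weightIdeal K n k)
    (fun p hp => mem_weightIdeal hp) (TwoSidedIdeal.zero_mem _)
    (fun _ _ _ _ => TwoSidedIdeal.add_mem _) (fun c _ _ => smul_mem_twoSidedIdeal _ c) hp

theorem bracket_ι_mem_span' (j : Fin n) {k : ℕ} {p : A K n}
    (hp : p ∈ Submodule.span K (commutatorProducts K n k)) :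
    ⁅FreeAlgebra.ι K j, p⁆ ∈ Submodule.span K (commutatorProducts K n (k + 1)) := by
  refine Submodule.span_induction (p := fun p _ => ⁅FreeAlgebra.ι K j, p⁆ ∈
    Submodule.span K (commutatorProducts K n (k + 1))) (fun p hp => bracket_ι_mem_span j hp)
    (by simp) ?_ ?_ hp
  · intro x y _ _ hx hy
    rw [bracket_add]
    exact add_mem hx hy
  · intro c x _ hx
    rw [bracket_smul]
    exact Submodule.smul_mem _ c hx

/-- Lowering the length of the first factor by one, which Leibniz's rule moves to the others. -/
theorem pureCommutator_mul_mem (i j : Fin n) (w : List (Fin n)) {k : ℕ} {p : A K n}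
    (hp : p ∈ Submodule.span K (commutatorProducts K n k)) :
    pureCommutator K (i :: j :: w) * p ∈ weightIdeal K n (w.length + k) := by
  induction w generalizing i j k p with
  | nil =>
    rw [List.length_nil, zero_add]
    exact TwoSidedIdeal.mul_mem_left _ _ _ (span_le_weightIdeal hp)
  | cons a w ih =>
    have : pureCommutator K (i :: j :: a :: w) =
      ⁅FreeAlgebra.ι K i, pureCommutator K (j :: a :: w)⁆ := rfl
    rw [this, eq_sub_of_add_eq (bracket_mul (FreeAlgebra.ι K i) _ _).symm, Ring.lie_def]
    have h₁ : pureCommutator K (j :: a :: w) * p ∈ weightIdeal K n ((a :: w).length + k) :=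
      span_le_weightIdeal (mul_mem_span_commutatorProducts (Submodule.subset_span
        (pureCommutator_mem_commutatorProducts (w := j :: a :: w) (by simp))) hp)
    have h₂ := ih j a (bracket_ι_mem_span' i hp)
    rw [show w.length + (k + 1) = (a :: w).length + k by simp; ring] at h₂
    exact TwoSidedIdeal.sub_mem _ (TwoSidedIdeal.sub_mem _ (TwoSidedIdeal.mul_mem_left _ _ _ h₁)
      (TwoSidedIdeal.mul_mem_right _ _ _ h₁)) h₂

theorem weightIdeal_succ_le (k : ℕ) : weightIdeal K n (k + 1) ≤ weightIdeal K n k := by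
  refine TwoSidedIdeal.span_le.2 ?_
  rintro _ ⟨ws, h, hk, rfl⟩
  rw [SetLike.mem_coe]
  match ws, h, hk with
  | [], _, hk => simp [weight] at hk
  | w :: ws, h, hk =>
    have hw : 2 ≤ w.length := h w (by simp)
    have hws : ∀ v ∈ ws, 2 ≤ v.length := fun v hv => h v (by simp [hv])
    have hwt : w.length - 1 + weight ws = k + 1 := by simpa [weight] using hk
    rw [List.map_cons, List.prod_cons]
    match w, hw, hwt with
    | i :: j :: w, _, hwt =>
      have := pureCommutator_mul_mem (K := K) i j w (Submodule.subset_span ⟨ws, hws, rfl, rfl⟩)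
      rwa [show w.length + weight ws = k by simp at hwt; omega] at this

theorem weightIdeal_mul_mem {k l : ℕ} {x y : A K n} (hx : x ∈ weightIdeal K n k)
    (hy : y ∈ weightIdeal K n l) : x * y ∈ weightIdeal K n (k + l) := by
  -- Commuting a generator past `q` costs a bracket of weight `m + 1`, harmless because the
  -- filtration decreases.
  have smul_closed : ∀ d y : A K n,
      (∀ m, ∀ q ∈ commutatorProducts K n m, q * y ∈ weightIdeal K n (m + l)) →
      ∀ m, ∀ q ∈ commutatorProducts K n m, q * (d * y) ∈ weightIdeal K n (m + l) := by
    intro d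
    induction d using FreeAlgebra.induction with
    | grade0 r =>
      intro y hy m q hq
      rw [← Algebra.smul_def, mul_smul_comm]
      exact smul_mem_twoSidedIdeal _ r (hy m q hq)
    | grade1 j =>
      intro y hy m q hq
      have : q * (FreeAlgebra.ι K j * y) =
          FreeAlgebra.ι K j * (q * y) - ⁅FreeAlgebra.ι K j, q⁆ * y := by
        simp only [Ring.lie_def]
        noncomm_ring
      rw [this]
      refine TwoSidedIdeal.sub_mem _ (TwoSidedIdeal.mul_mem_left _ _ _ (hy m q hq)) ?_
      refine Submodule.span_induction (p := fun q _ => q * y ∈ weightIdeal K n (m + l)) ?_ ?_ ?_ ?_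
        (bracket_ι_mem_span j hq)
      · intro q hq
        have := hy (m + 1) q hq
        rw [show m + 1 + l = m + l + 1 by ring] at this
        exact weightIdeal_succ_le _ this
      · simp
      · intro p q _ _ hp hq
        rw [add_mul]
        exact TwoSidedIdeal.add_mem _ hp hq
      · intro c q _ hq
        rw [smul_mul_assoc]
        exact smul_mem_twoSidedIdeal _ c hq
    | mul a b ha hb =>
      intro y hy m q hq
      rw [mul_assoc a]
      exact ha _ (hb y hy) m q hq
    | add a b ha hb =>
      intro y hy m q hq
      rw [add_mul, mul_add]
      exact TwoSidedIdeal.add_mem _ (ha y hy m q hq) (hb y hy m q hq)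
  have key : ∀ m, ∀ q ∈ commutatorProducts K n m, q * y ∈ weightIdeal K n (m + l) := by
    refine TwoSidedIdeal.span_induction (p := fun y _ => ∀ m, ∀ q ∈ commutatorProducts K n m,
      q * y ∈ weightIdeal K n (m + l)) ?_ ?_ ?_ ?_ ?_ ?_ hy
    · exact fun y hy m q hq => mem_weightIdeal (mul_mem_commutatorProducts hq hy)
    · simp
    · intro y z _ _ hy hz m q hq
      rw [mul_add]
      exact TwoSidedIdeal.add_mem _ (hy m q hq) (hz m q hq)
    · intro y _ hy m q hq
      rw [mul_neg]
      exact TwoSidedIdeal.neg_mem _ (hy m q hq)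
    · exact fun d y _ hy => smul_closed d y hy
    · intro d y _ hy m q hq
      rw [← mul_assoc]
      exact TwoSidedIdeal.mul_mem_right _ _ _ (hy m q hq)
  suffices H : ∀ a, x * (a * y) ∈ weightIdeal K n (k + l) by simpa using H 1
  refine TwoSidedIdeal.span_induction
    (p := fun x _ => ∀ a, x * (a * y) ∈ weightIdeal K n (k + l)) ?_ ?_ ?_ ?_ ?_ ?_ hx
  · exact fun q hq a => smul_closed a y key k q hq
  · simp
  · intro x z _ _ hx hz a
    rw [add_mul]
    exact TwoSidedIdeal.add_mem _ (hx a) (hz a)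
  · intro x _ hx a
    rw [neg_mul]
    exact TwoSidedIdeal.neg_mem _ (hx a)
  · intro b x _ hx a
    rw [mul_assoc]
    exact TwoSidedIdeal.mul_mem_left _ _ _ (hx a)
  · intro b x _ hx a
    rw [mul_assoc, ← mul_assoc b]
    exact hx _

theorem bracket_mem_weightIdeal_one (a b : A K n) : ⁅a, b⁆ ∈ weightIdeal K n 1 :=
  bracket_mem_of_generators _ (fun i j =>
    mem_weightIdeal (pureCommutator_mem_commutatorProducts (w := [i, j]) le_rfl)) a b

/-- On generators of the ideal this is Leibniz in `a`. For multiples `b * x`, the extra term `⁅a, b⁆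
* x` is handled by multiplicativity of the filtration. -/
theorem bracket_mem_weightIdeal (a : A K n) {k : ℕ} {x : A K n} (hx : x ∈ weightIdeal K n k) :
    ⁅a, x⁆ ∈ weightIdeal K n (k + 1) := by
  refine TwoSidedIdeal.span_induction
    (p := fun x _ => x ∈ weightIdeal K n k ∧ ⁅a, x⁆ ∈ weightIdeal K n (k + 1))
    ?_ ?_ ?_ ?_ ?_ ?_ hx |>.2
  · intro p hp
    refine ⟨mem_weightIdeal hp, ?_⟩
    induction a using FreeAlgebra.induction with
    | grade0 r =>
      rw [Ring.lie_def, Algebra.commutes, sub_self]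
      exact TwoSidedIdeal.zero_mem _
    | grade1 j => exact span_le_weightIdeal (bracket_ι_mem_span j hp)
    | mul a b ha hb =>
      rw [mul_bracket]
      exact TwoSidedIdeal.add_mem _ (TwoSidedIdeal.mul_mem_right _ _ _ ha)
        (TwoSidedIdeal.mul_mem_left _ _ _ hb)
    | add a b ha hb =>
      rw [add_bracket]
      exact TwoSidedIdeal.add_mem _ ha hb
  · simp
  · rintro x y _ _ ⟨hx, hx'⟩ ⟨hy, hy'⟩
    rw [bracket_add]
    exact ⟨TwoSidedIdeal.add_mem _ hx hy, TwoSidedIdeal.add_mem _ hx' hy'⟩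
  · rintro x _ ⟨hx, hx'⟩
    rw [← neg_one_smul K, bracket_smul]
    exact ⟨smul_mem_twoSidedIdeal _ _ hx, smul_mem_twoSidedIdeal _ _ hx'⟩
  · rintro b x _ ⟨hx, hx'⟩
    refine ⟨TwoSidedIdeal.mul_mem_left _ _ _ hx, ?_⟩
    rw [bracket_mul]
    have := weightIdeal_mul_mem (bracket_mem_weightIdeal_one a b) hx
    rw [add_comm] at this
    exact TwoSidedIdeal.add_mem _ this (TwoSidedIdeal.mul_mem_left _ _ _ hx')
  · rintro b x _ ⟨hx, hx'⟩
    refine ⟨TwoSidedIdeal.mul_mem_right _ _ _ hx, ?_⟩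
    rw [bracket_mul]
    exact TwoSidedIdeal.add_mem _ (TwoSidedIdeal.mul_mem_right _ _ _ hx')
      (weightIdeal_mul_mem hx (bracket_mem_weightIdeal_one a b))

theorem one_mem_weightIdeal_zero : (1 : A K n) ∈ weightIdeal K n 0 :=
  mem_weightIdeal ⟨[], by simp, rfl, rfl⟩

theorem M_le_weightIdeal (k : ℕ) : M K (A K n) (k + 1) ≤ weightIdeal K n k := by
  refine TwoSidedIdeal.span_le.2 fun x hx => ?_
  rw [SetLike.mem_coe]
  rw [SetLike.mem_coe] at hx
  induction k generalizing x with
  | zero => simpa using TwoSidedIdeal.mul_mem_left _ x _ one_mem_weightIdeal_zero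
  | succ k ih =>
    exact L_induction (P := fun x => x ∈ weightIdeal K n (k + 1))
      (fun a l hl => bracket_mem_weightIdeal a (ih l hl)) (TwoSidedIdeal.zero_mem _)
      (fun _ _ => TwoSidedIdeal.add_mem _) (fun c _ => smul_mem_twoSidedIdeal _ c) hx

theorem weightIdeal_le_M [CharZero K] (k : ℕ) : weightIdeal K 2 k ≤ M K (A K 2) (k + 1) := by
  refine TwoSidedIdeal.span_le.2 ?_
  rintro _ ⟨ws, h, rfl, rfl⟩
  rw [SetLike.mem_coe]
  induction ws with
  | nil => exact L_le_M (mem_L_one _)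
  | cons w ws ih =>
    have hw : 2 ≤ w.length := h w (by simp)
    have hL := pureCommutator_mem_L (K := K) w
    rw [show w.length = w.length - 1 + 1 by omega] at hL
    have := L_mul_M_mem lie_M_two_mem_L_three hL (ih fun v hv => h v (by simp [hv]))
    simpa [weight] using this

end FreeAlgebra

/-! ### A representation detecting the weight -/

section Representation

open Polynomial

variable (K : Type*) [Field K]

/-- Multiplication by the variable `X` on `K[h][X]`. -/
noncomputable def position : Module.End K[X] K[X][X] := LinearMap.mulLeft K[X] X

/-- The shift `f(X) ↦ f(X + h)` on `K[h][X]`. -/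
noncomputable def shift : Module.End K[X] K[X][X] := taylor (X : K[X])

theorem position_shift_commutator :
    position K * shift K - shift K * position K = (-X : K[X]) • shift K := by
  ext1 k
  simp only [position, shift]
  ext1
  simp [smul_eq_C_mul]
  ring

/-- The representation of the free algebra on `K[h][X]` with `x_0 ↦ X` and `x_1 ↦ X + shift`. -/
noncomputable def shiftRep : A K 2 →ₐ[K] Module.End K[X] K[X][X] :=
  FreeAlgebra.lift K ![position K, position K + shift K]

theorem shiftRep_ι_zero : shiftRep K (FreeAlgebra.ι K 0) = position K := by
  simp [shiftRep]

theorem shiftRep_ι_one : shiftRep K (FreeAlgebra.ι K 1) = position K + shift K := by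
  simp [shiftRep]

theorem shiftRep_bracket (x y : A K 2) :
    shiftRep K ⁅x, y⁆ = shiftRep K x * shiftRep K y - shiftRep K y * shiftRep K x := by
  simp [Ring.lie_def]

theorem shiftRep_bracket_generators :
    shiftRep K ⁅FreeAlgebra.ι K (0 : Fin 2), FreeAlgebra.ι K 1⁆ = (-X : K[X]) • shift K := by
  rw [shiftRep_bracket, shiftRep_ι_zero, shiftRep_ι_one, ← position_shift_commutator]
  noncomm_ring

/-- The summand `X` in the image of `x_1` makes both generators act alike on multiples of the shift,
so no further bracket kills a commutator. -/
theorem shiftRep_bracket_smul_shift (j : Fin 2) {x : A K 2} {a : K[X]}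
    (hx : shiftRep K x = a • shift K) :
    shiftRep K ⁅FreeAlgebra.ι K j, x⁆ = (-X * a) • shift K := by
  have h : shiftRep K (FreeAlgebra.ι K j) * shift K - shift K * shiftRep K (FreeAlgebra.ι K j) =
      (-X : K[X]) • shift K := by
    have hj : j = 0 ∨ j = 1 := by omega
    rcases hj with rfl | rfl
    · rw [shiftRep_ι_zero, position_shift_commutator]
    · rw [shiftRep_ι_one, ← position_shift_commutator]
      noncomm_ring
  rw [shiftRep_bracket, hx, mul_smul_comm, smul_mul_assoc]
  refine (smul_sub a (_ : Module.End K[X] K[X][X]) _).symm.trans ?_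
  rw [h, smul_smul, mul_comm]

theorem shiftRep_pureCommutator {w : List (Fin 2)} (hw : 2 ≤ w.length) :
    pureCommutator K w = 0 ∨ ∃ c : K, c ≠ 0 ∧
      shiftRep K (pureCommutator K w) = (C c * X ^ (w.length - 1)) • shift K := by
  match w, hw with
  | [i, j], _ =>
    have hp : pureCommutator K [i, j] = ⁅FreeAlgebra.ι K i, FreeAlgebra.ι K j⁆ := rfl
    rw [hp]
    have hi : i = 0 ∨ i = 1 := by omega
    have hj : j = 0 ∨ j = 1 := by omega
    rcases hi with rfl | rfl <;> rcases hj with rfl | rfl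
    · left
      rw [Ring.lie_def, sub_self]
    · exact Or.inr ⟨-1, by simp, by rw [shiftRep_bracket_generators]; simp⟩
    · refine Or.inr ⟨1, by simp, ?_⟩
      rw [← bracket_skew, map_neg, shiftRep_bracket_generators]
      refine (neg_smul (-X : K[X]) (shift K)).symm.trans ?_
      simp
    · left
      rw [Ring.lie_def, sub_self]
  | a :: b :: d :: w, _ =>
    have hp : pureCommutator K (a :: b :: d :: w) =
      ⁅FreeAlgebra.ι K a, pureCommutator K (b :: d :: w)⁆ := rfl
    rw [hp]
    rcases shiftRep_pureCommutator (w := b :: d :: w) (by simp) with h | ⟨c, hc, h⟩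
    · left
      rw [h, bracket_zero]
    · refine Or.inr ⟨-c, neg_ne_zero.2 hc, ?_⟩
      rw [shiftRep_bracket_smul_shift K a h]
      congr 1
      simp
      ring

theorem shiftRep_prod (ws : List (List (Fin 2))) (hws : ∀ w ∈ ws, 2 ≤ w.length) :
    (ws.map (pureCommutator K)).prod = 0 ∨ ∃ c : K, c ≠ 0 ∧
      shiftRep K (ws.map (pureCommutator K)).prod =
        (C c * X ^ weight ws) • shift K ^ ws.length := by
  induction ws with
  | nil => exact Or.inr ⟨1, one_ne_zero, by simp [weight]⟩
  | cons w ws ih =>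
    rw [List.map_cons, List.prod_cons]
    rcases shiftRep_pureCommutator K (hws w (by simp)) with h | ⟨c, hc, h⟩
    · simp [h]
    rcases ih fun v hv => hws v (by simp [hv]) with h' | ⟨c', hc', h'⟩
    · simp [h']
    refine Or.inr ⟨c * c', mul_ne_zero hc hc', ?_⟩
    rw [map_mul, h, h', smul_mul_smul_comm, List.length_cons, pow_succ']
    congr 1
    simp [weight, pow_add]
    ring

/-- Operators with image in `h^k K[h][X]` form a two-sided ideal, by `K[h]`-linearity. -/
theorem shiftRep_dvd {k : ℕ} {x : A K 2} (hx : x ∈ weightIdeal K 2 k) (f : K[X][X]) :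
    C ((X : K[X]) ^ k) ∣ shiftRep K x f := by
  revert f
  refine TwoSidedIdeal.span_induction
    (p := fun x _ => ∀ f : K[X][X], C ((X : K[X]) ^ k) ∣ shiftRep K x f) ?_ ?_ ?_ ?_ ?_ ?_ hx
  · rintro _ ⟨ws, hws, rfl, rfl⟩ f
    rcases shiftRep_prod K ws hws with h | ⟨c, -, h⟩
    · simp [h]
    · rw [h, LinearMap.smul_apply, smul_eq_C_mul, C_mul, mul_comm (C (C c)), mul_assoc]
      exact dvd_mul_right _ _
  · simp
  · intro x y _ _ hx hy f
    rw [map_add]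
    exact dvd_add (hx f) (hy f)
  · intro x _ hx f
    rw [map_neg]
    exact (hx f).neg_right
  · intro a x _ hx f
    obtain ⟨g, hg⟩ := hx f
    rw [map_mul, Module.End.mul_apply, hg, ← smul_eq_C_mul, map_smul, smul_eq_C_mul]
    exact dvd_mul_right _ _
  · intro a x _ hx f
    rw [map_mul, Module.End.mul_apply]
    exact hx _

theorem prod_notMem_weightIdeal (ws : List (List (Fin 2))) (hws : ∀ w ∈ ws, 2 ≤ w.length)
    (h0 : (ws.map (pureCommutator K)).prod ≠ 0) :
    (ws.map (pureCommutator K)).prod ∉ weightIdeal K 2 (weight ws + 1) := by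
  intro hmem
  obtain ⟨c, hc, h⟩ := (shiftRep_prod K ws hws).resolve_left h0
  -- The constant `1` is fixed by the shift, so only the scalar `c * h ^ weight ws` remains.
  have hdvd := shiftRep_dvd K hmem 1
  have hone (m : ℕ) : (shift K ^ m) 1 = 1 := by
    induction m with
    | zero => simp
    | succ m ih => rw [pow_succ', Module.End.mul_apply, ih, shift, taylor_one, C_1]
  rw [h, LinearMap.smul_apply, hone, smul_eq_C_mul, mul_one, C_dvd_iff_dvd_coeff] at hdvd
  have := hdvd 0
  rw [coeff_C_zero, X_pow_dvd_iff] at this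
  exact hc (by simpa using this (weight ws) (Nat.lt_succ_self _))

end Representation

/-! ### Conclusion -/

theorem M_eq_span_S (K : Type*) [Field K] [CharZero K] (k : ℕ) :
    M K (A K 2) (k + 1) = TwoSidedIdeal.span (S K 2 (k + 1)) := by
  refine le_antisymm ((M_le_weightIdeal k).trans ?_) (TwoSidedIdeal.span_le.2 fun p hp => hp.2.1)
  refine TwoSidedIdeal.span_le.2 ?_
  rintro _ ⟨ws, hws, rfl, rfl⟩
  by_cases h0 : (ws.map (pureCommutator K)).prod = 0
  · rw [h0]
    exact TwoSidedIdeal.zero_mem _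
  · refine TwoSidedIdeal.subset_span ⟨⟨h0, ws, hws, rfl⟩, ?_, ?_⟩
    · exact weightIdeal_le_M _ (mem_weightIdeal ⟨ws, hws, rfl, rfl⟩)
    · exact fun h => prod_notMem_weightIdeal K ws hws h0 (M_le_weightIdeal _ h)

theorem exists_quotAlg_algEquiv {K R : Type*} [Field K] [Ring R] [Algebra K R]
    {I J : TwoSidedIdeal R} (h : I = J) :
    ∃ θ : QuotAlg I ≃ₐ[K] QuotAlg J,
      ∀ a : R, θ (RingCon.mk' I.ringCon a) = RingCon.mk' J.ringCon a := by
  subst h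
  exact ⟨AlgEquiv.refl, fun _ => rfl⟩

end LowerCentral

theorem mainTheorem7 (K : Type*) [Field K] [CharZero K] (i : ℕ) (hi : 2 ≤ i) :
    LowerCentral.M K (LowerCentral.A K 2) i = TwoSidedIdeal.span (LowerCentral.S K 2 i) ∧
    ∃ θ : LowerCentral.QuotAlg (TwoSidedIdeal.span (LowerCentral.S K 2 i)) ≃ₐ[K]
        LowerCentral.Q K 2 i,
      ∀ a : LowerCentral.A K 2,
        θ (RingCon.mk' (TwoSidedIdeal.span (LowerCentral.S K 2 i)).ringCon a) =
          RingCon.mk' (LowerCentral.M K (LowerCentral.A K 2) i).ringCon a := by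
  obtain ⟨k, rfl⟩ : ∃ k, i = k + 1 := ⟨i - 1, by omega⟩
  exact ⟨LowerCentral.M_eq_span_S K k,
    LowerCentral.exists_quotAlg_algEquiv (LowerCentral.M_eq_span_S K k).symm⟩
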